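/- Let $\mathcal Y$ be a nonempty finite set with $d=|\mathcal Y|$, and let $(\gamma_y)_{y\in\mathcal Y}$ be i.i.d. real random variables whose common law has a smooth ($C^\infty$) probability density $q$ with respect to Lebesgue measure on $\mathbb R$. Assume that for every $\theta\in\mathbb R^{\mathcal Y}\cong\mathbb R^d$ the random variable $\max_{y\in\mathcal Y}(\theta_y+\gamma_y)$ is integrable, so that $$f(\theta)=\mathbb E\Big[\max_{y\in\mathcal Y}(\theta_y+\gamma_y)\Big]$$ is finite on all of $\mathbb R^d$. For $\theta\in\mathbb R^d$ let $p(\theta)\in\mathbb R^d$ be the vector of argmax probabilities, $p(\theta)_y=P\big(\theta_y+\gamma_y\ge\theta_z+\gamma_z\ \text{for all } z\in\mathcal Y\big)$, let $\partial f(\theta)=\{\lambda\in\mathbb R^d : f(z)\ge f(\theta)+\langle\lambda,z-\theta\rangle\ \text{for all } z\in\mathbb R^d\}$ be the subdifferential of $f$ at $\theta$, and let $\operatorname{range}\partial f=\bigcup_{\theta\in\mathbb R^d}\partial f(\theta)$. Let $\Delta=\{\lambda\in\mathbb R^d:\lambda_y\ge 0\ \text{for all } y,\ \sum_y\lambda_y=1\}$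 be the probability simplex and $\operatorname{ri}(\Delta)$ its relative interior. Then for every $\theta\in\mathbb R^d$ the function $f$ is differentiable at $\theta$ with $\nabla f(\theta)=p(\theta)$, and $\partial f(\theta)=\{p(\theta)\}$; in particular $\operatorname{range}\partial f$ is the set of all argmax probability vectors. Moreover $$\operatorname{ri}(\Delta)\subseteq\operatorname{range}\partial f\subseteq\Delta .$$ -/

import Mathlib

open MeasureTheory ProbabilityTheory

noncomputable section

/-- The perturbed maximum `max_y (θ_y + γ_y)`, at the outcome `a`. -/
def perturbedMax {𝒴 Ω : Type*} [Fintype 𝒴] [Nonempty 𝒴]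
    (γ : 𝒴 → Ω → ℝ) (θ : EuclideanSpace ℝ 𝒴) (a : Ω) : ℝ :=
  Finset.univ.sup' Finset.univ_nonempty (fun y => θ y + γ y a)

/-- The expected perturbed maximum `f(θ) = 𝔼[max_y (θ_y + γ_y)]`. -/
def expectedPerturbedMax {𝒴 Ω : Type*} [Fintype 𝒴] [Nonempty 𝒴] [MeasurableSpace Ω]
    (γ : 𝒴 → Ω → ℝ) (P : Measure Ω) (θ : EuclideanSpace ℝ 𝒴) : ℝ :=
  ∫ a, perturbedMax γ θ a ∂P

/-- The vector of argmax probabilities: its `y`-th coordinate is the probability that `y`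
maximizes `θ_y + γ_y`. -/
def argmaxProb {𝒴 Ω : Type*} [Fintype 𝒴] [MeasurableSpace Ω]
    (γ : 𝒴 → Ω → ℝ) (P : Measure Ω) (θ : EuclideanSpace ℝ 𝒴) : EuclideanSpace ℝ 𝒴 :=
  WithLp.toLp 2 (fun y => P.real {a | ∀ z, θ z + γ z a ≤ θ y + γ y a})

/-- The subdifferential `∂f(θ)`: all `v` with `f(z) ≥ f(θ) + ⟨v, z - θ⟩` for every `z`. -/
def subdifferential {E : Type*} [NormedAddCommGroup E] [InnerProductSpace ℝ E]
    (f : E → ℝ) (θ : E) : Set E :=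
  {v | ∀ z, f θ + inner ℝ v (z - θ) ≤ f z}

/-- `range ∂f = ⋃_θ ∂f(θ)`. -/
def rangeSubdifferential {E : Type*} [NormedAddCommGroup E] [InnerProductSpace ℝ E]
    (f : E → ℝ) : Set E :=
  ⋃ θ, subdifferential f θ

/-- The probability simplex in Euclidean space. -/
def probSimplex (𝒴 : Type*) [Fintype 𝒴] : Set (EuclideanSpace ℝ 𝒴) :=
  {p | (∀ y, 0 ≤ p y) ∧ ∑ y, p y = 1}

end

/-! Since the noise law has no atoms, ties have probability zero at each fixed `θ`. Off ties the
pathwise maximum is differentiable, with derivative the projection onto its unique maximizer. It is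
also 1-Lipschitz in `θ`, so dominated differentiation gives `∇f = p`, and a subgradient at a point
of differentiability is the gradient.

For the inner inclusion, `p` is a subgradient at any minimizer of `f - ⟨p, ·⟩`. This function is
invariant under adding constants when `∑ p = 1`, so one may assume `min θ = 0`; there it is coercive
if `p > 0` (`exists_coercive_bound`), and a minimizer exists by compactness. -/

open Set Filter Topology

/-! ### Pathwise maximum and differentiation under the integral. -/

section PerturbedMax

variable {𝒴 Ω : Type*} [Fintype 𝒴]

/-- The event that `y` attains the perturbed maximum. -/
def argmaxEvent (γ : 𝒴 → Ω → ℝ) (θ : EuclideanSpace ℝ 𝒴) (y : 𝒴) : Set Ω :=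
  {a | ∀ z, θ z + γ z a ≤ θ y + γ y a}

/-- The functional evaluating at the maximizers of the perturbed maximum. -/
noncomputable def argmaxEval (γ : 𝒴 → Ω → ℝ) (θ : EuclideanSpace ℝ 𝒴) (a : Ω) :
    EuclideanSpace ℝ 𝒴 →L[ℝ] ℝ :=
  ∑ y, (argmaxEvent γ θ y).indicator (fun _ => (EuclideanSpace.proj y : EuclideanSpace ℝ 𝒴 →L[ℝ] ℝ)) a

variable {γ : 𝒴 → Ω → ℝ}

theorem argmaxEval_eq_proj {θ : EuclideanSpace ℝ 𝒴} {a : Ω} {y : 𝒴}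
    (h : ∀ z, z ≠ y → θ z + γ z a < θ y + γ y a) :
    argmaxEval γ θ a = EuclideanSpace.proj y := by
  unfold argmaxEval
  rw [Finset.sum_eq_single y]
  · refine indicator_of_mem (fun z => ?_) _
    by_cases hz : z = y
    · rw [hz]
    · exact (h z hz).le
  · intro z _ hz
    exact indicator_of_notMem (fun hm : a ∈ argmaxEvent γ θ z => absurd (hm y) (not_le.2 (h z hz))) _
  · simp

section Integral

variable [MeasurableSpace Ω] {P : Measure Ω}

theorem nullMeasurableSet_argmaxEvent (hγ : ∀ y, AEMeasurable (γ y) P)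
    (θ : EuclideanSpace ℝ 𝒴) (y : 𝒴) : NullMeasurableSet (argmaxEvent γ θ y) P := by
  have : argmaxEvent γ θ y = ⋂ z, {a | θ z + γ z a ≤ θ y + γ y a} := by
    ext a; simp [argmaxEvent]
  rw [this]
  exact NullMeasurableSet.iInter fun z =>
    nullMeasurableSet_le ((hγ z).const_add _) ((hγ y).const_add _)

theorem integrable_argmaxEval [IsFiniteMeasure P] (hγ : ∀ y, AEMeasurable (γ y) P)
    (θ : EuclideanSpace ℝ 𝒴) : Integrable (argmaxEval γ θ) P := by
  exact integrable_finsetSum Finset.univ (f := fun y => (argmaxEvent γ θ y).indicator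
      fun _ => (EuclideanSpace.proj y : EuclideanSpace ℝ 𝒴 →L[ℝ] ℝ)) fun y _ =>
    (integrable_const (EuclideanSpace.proj y : EuclideanSpace ℝ 𝒴 →L[ℝ] ℝ)).indicator₀
      (nullMeasurableSet_argmaxEvent hγ θ y)

theorem integral_argmaxEval [IsFiniteMeasure P] (hγ : ∀ y, AEMeasurable (γ y) P)
    (θ : EuclideanSpace ℝ 𝒴) :
    ∫ a, argmaxEval γ θ a ∂P = InnerProductSpace.toDual ℝ _ (argmaxProb γ P θ) := by
  unfold argmaxEval
  rw [integral_finsetSum _ fun y _ =>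
    (integrable_const (EuclideanSpace.proj y : EuclideanSpace ℝ 𝒴 →L[ℝ] ℝ)).indicator₀
      (nullMeasurableSet_argmaxEvent hγ θ y)]
  ext v
  rw [_root_.sum_apply, InnerProductSpace.toDual_apply_apply, PiLp.inner_apply]
  refine Finset.sum_congr rfl fun y _ => ?_
  rw [integral_indicator₀ (nullMeasurableSet_argmaxEvent hγ θ y), setIntegral_const]
  simp [argmaxProb, argmaxEvent, mul_comm]

end Integral

variable [Nonempty 𝒴]

theorem le_perturbedMax (θ : EuclideanSpace ℝ 𝒴) (a : Ω) (y : 𝒴) :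
    θ y + γ y a ≤ perturbedMax γ θ a :=
  Finset.le_sup' (fun y => θ y + γ y a) (Finset.mem_univ y)

theorem perturbedMax_le {θ : EuclideanSpace ℝ 𝒴} {a : Ω} {c : ℝ}
    (h : ∀ y, θ y + γ y a ≤ c) : perturbedMax γ θ a ≤ c :=
  Finset.sup'_le _ _ fun y _ => h y

theorem exists_perturbedMax_eq (γ : 𝒴 → Ω → ℝ) (θ : EuclideanSpace ℝ 𝒴) (a : Ω) :
    ∃ y, perturbedMax γ θ a = θ y + γ y a := by
  obtain ⟨y, -, hy⟩ := Finset.exists_mem_eq_sup' Finset.univ_nonempty (fun y => θ y + γ y a)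
  exact ⟨y, hy⟩

theorem perturbedMax_le_add_norm_sub (θ η : EuclideanSpace ℝ 𝒴) (a : Ω) :
    perturbedMax γ θ a ≤ perturbedMax γ η a + ‖θ - η‖ := by
  refine perturbedMax_le fun y => ?_
  have h1 := le_perturbedMax (γ := γ) η a y
  have h2 := (le_abs_self _).trans (PiLp.norm_apply_le (θ - η) y)
  simp only [PiLp.sub_apply] at h2
  linarith

theorem lipschitzWith_perturbedMax (a : Ω) :
    LipschitzWith 1 (fun θ : EuclideanSpace ℝ 𝒴 => perturbedMax γ θ a) := by
  refine LipschitzWith.of_le_add fun θ η => ?_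
  rw [dist_eq_norm]
  exact perturbedMax_le_add_norm_sub θ η a

theorem perturbedMax_eq_of_forall_le {θ : EuclideanSpace ℝ 𝒴} {a : Ω} {y : 𝒴}
    (h : ∀ z, θ z + γ z a ≤ θ y + γ y a) : perturbedMax γ θ a = θ y + γ y a :=
  le_antisymm (perturbedMax_le h) (le_perturbedMax θ a y)

theorem hasFDerivAt_perturbedMax {θ : EuclideanSpace ℝ 𝒴} {a : Ω} {y : 𝒴}
    (h : ∀ z, z ≠ y → θ z + γ z a < θ y + γ y a) :
    HasFDerivAt (fun η => perturbedMax γ η a) (EuclideanSpace.proj (𝕜 := ℝ) y) θ := by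
  have h1 : HasFDerivAt (fun η : EuclideanSpace ℝ 𝒴 => η y + γ y a)
      (EuclideanSpace.proj (𝕜 := ℝ) y) θ :=
    (EuclideanSpace.proj y : EuclideanSpace ℝ 𝒴 →L[ℝ] ℝ).hasFDerivAt.add_const (γ y a)
  refine h1.congr_of_eventuallyEq ?_
  have h2 : ∀ᶠ η : EuclideanSpace ℝ 𝒴 in 𝓝 θ, ∀ z, z ≠ y → η z + γ z a < η y + γ y a := by
    refine eventually_all.2 fun z => ?_
    by_cases hz : z = y
    · exact Eventually.of_forall fun η hz' => absurd hz hz'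
    · have hl : ContinuousAt (fun η : EuclideanSpace ℝ 𝒴 => η z + γ z a) θ := by fun_prop
      have hr : ContinuousAt (fun η : EuclideanSpace ℝ 𝒴 => η y + γ y a) θ := by fun_prop
      filter_upwards [hl.eventually_lt hr (h z hz)] with η hη _ using hη
  filter_upwards [h2] with η hη
  refine perturbedMax_eq_of_forall_le fun z => ?_
  by_cases hz : z = y
  · rw [hz]
  · exact (hη z hz).le

theorem exists_strict_maximizer {θ : EuclideanSpace ℝ 𝒴} {a : Ω}
    (h : ∀ y z, y ≠ z → θ y + γ y a ≠ θ z + γ z a) :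
    ∃ y, ∀ z, z ≠ y → θ z + γ z a < θ y + γ y a := by
  obtain ⟨y, hy⟩ := exists_perturbedMax_eq γ θ a
  exact ⟨y, fun z hz => lt_of_le_of_ne (hy ▸ le_perturbedMax θ a z) (h z y hz)⟩

variable [MeasurableSpace Ω] {P : Measure Ω}

theorem hasGradientAt_expectedPerturbedMax [IsFiniteMeasure P]
    (hγ : ∀ y, AEMeasurable (γ y) P)
    (hint : ∀ θ : EuclideanSpace ℝ 𝒴, Integrable (perturbedMax γ θ) P)
    {θ : EuclideanSpace ℝ 𝒴} (hties : ∀ᵐ a ∂P, ∀ y z, y ≠ z → θ y + γ y a ≠ θ z + γ z a) :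
    HasGradientAt (expectedPerturbedMax γ P) (argmaxProb γ P θ) θ := by
  rw [hasGradientAt_iff_hasFDerivAt, ← integral_argmaxEval hγ]
  refine (hasFDerivAt_integral_of_dominated_loc_of_lip (bound := fun _ => (1 : ℝ))
    univ_mem (Eventually.of_forall fun η => (hint η).aestronglyMeasurable) (hint θ)
    (integrable_argmaxEval hγ θ).aestronglyMeasurable (ae_of_all _ fun a => ?_)
    (integrable_const _) ?_).2
  · have := (lipschitzWith_perturbedMax (γ := γ) a).lipschitzOnWith (s := univ)
    simpa using this
  · filter_upwards [hties] with a ha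
    obtain ⟨y, hy⟩ := exists_strict_maximizer ha
    rw [argmaxEval_eq_proj hy]
    exact hasFDerivAt_perturbedMax hy

/-- The subgradient inequality holds pathwise off ties, by testing the maximum at `η` on the
maximizer for `θ`; it is then integrated. -/
theorem argmaxProb_mem_subdifferential [IsFiniteMeasure P]
    (hγ : ∀ y, AEMeasurable (γ y) P)
    (hint : ∀ θ : EuclideanSpace ℝ 𝒴, Integrable (perturbedMax γ θ) P)
    {θ : EuclideanSpace ℝ 𝒴} (hties : ∀ᵐ a ∂P, ∀ y z, y ≠ z → θ y + γ y a ≠ θ z + γ z a) :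
    argmaxProb γ P θ ∈ subdifferential (expectedPerturbedMax γ P) θ := by
  intro η
  have hE := integrable_argmaxEval hγ θ
  have h1 : inner ℝ (argmaxProb γ P θ) (η - θ) = ∫ a, argmaxEval γ θ a (η - θ) ∂P := by
    rw [← ContinuousLinearMap.integral_apply hE, integral_argmaxEval hγ,
      InnerProductSpace.toDual_apply_apply]
  rw [h1, expectedPerturbedMax, expectedPerturbedMax,
    ← integral_add (hint θ) (hE.apply_continuousLinearMap _)]
  refine integral_mono_ae ((hint θ).add (hE.apply_continuousLinearMap _)) (hint η) ?_
  filter_upwards [hties] with a ha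
  obtain ⟨y, hy⟩ := exists_strict_maximizer ha
  have h2 := le_perturbedMax (γ := γ) η a y
  have h3 : perturbedMax γ θ a = θ y + γ y a := perturbedMax_eq_of_forall_le fun z => by
    by_cases hz : z = y
    · rw [hz]
    · exact (hy z hz).le
  have h4 : argmaxEval γ θ a (η - θ) = η y - θ y := by
    rw [argmaxEval_eq_proj hy]; rfl
  rw [h3, h4]
  linarith

end PerturbedMax

/-! ### Subgradients at points of differentiability. -/

section Subdifferential

variable {E : Type*} [NormedAddCommGroup E] [InnerProductSpace ℝ E] [CompleteSpace E]

theorem eq_of_mem_subdifferential_of_hasGradientAt {f : E → ℝ} {x v g : E}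
    (hv : v ∈ subdifferential f x) (hg : HasGradientAt f g x) : v = g := by
  have h1 : HasFDerivAt (fun z => f z - inner ℝ v z)
      (InnerProductSpace.toDual ℝ E g - InnerProductSpace.toDual ℝ E v) x :=
    hg.hasFDerivAt.sub (InnerProductSpace.toDual ℝ E v).hasFDerivAt
  -- The subgradient inequality says that `x` minimizes `f - ⟨v, ·⟩`.
  have h2 : IsLocalMin (fun z => f z - inner ℝ v z) x := Eventually.of_forall fun z => by
    have := hv z
    rw [inner_sub_right] at this
    change f x - inner ℝ v x ≤ f z - inner ℝ v z
    linarith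
  have h3 := h2.hasFDerivAt_eq_zero h1
  exact ((InnerProductSpace.toDual ℝ E).injective (sub_eq_zero.1 h3)).symm

end Subdifferential

/-! ### Relative interior of the simplex. -/

section Simplex

theorem exists_lineMap_mem_of_mem_intrinsicInterior {E : Type*} [NormedAddCommGroup E]
    [NormedSpace ℝ E] {s : Set E} {x c : E} (hx : x ∈ intrinsicInterior ℝ s) (hc : c ∈ s) :
    ∃ t : ℝ, 1 < t ∧ AffineMap.lineMap c x t ∈ s := by
  obtain ⟨x, hx, rfl⟩ := hx
  have hc' := subset_affineSpan ℝ s hc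
  let g : ℝ → affineSpan ℝ s := fun t =>
    ⟨AffineMap.lineMap c (x : E) t, AffineMap.lineMap_mem t hc' x.2⟩
  have hg : Continuous g := AffineMap.lineMap_continuous.subtype_mk _
  have hg1 : g 1 = x := Subtype.ext (AffineMap.lineMap_apply_one _ _)
  have h1 : ∀ᶠ t in 𝓝 (1 : ℝ), g t ∈ ((↑) ⁻¹' s : Set (affineSpan ℝ s)) :=
    hg.continuousAt.eventually_mem (hg1.symm ▸ mem_interior_iff_mem_nhds.1 hx)
  obtain ⟨t, ht, ht1⟩ :=
    ((h1.filter_mono nhdsWithin_le_nhds).and (self_mem_nhdsWithin (s := Ioi (1 : ℝ)))).exists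
  exact ⟨t, ht1, ht⟩

theorem pos_of_mem_intrinsicInterior_probSimplex {𝒴 : Type*} [Fintype 𝒴]
    {p : EuclideanSpace ℝ 𝒴} (hp : p ∈ intrinsicInterior ℝ (probSimplex 𝒴)) (y : 𝒴) :
    0 < p y := by
  classical
  have hp' : p ∈ probSimplex 𝒴 := intrinsicInterior_subset hp
  have hc : EuclideanSpace.single y (1 : ℝ) ∈ probSimplex 𝒴 := by
    refine ⟨fun z => ?_, by simp⟩
    by_cases h : z = y <;> simp [h]
  -- Going from the vertex at `y` slightly beyond `p` would make coordinate `y` negative if `p y ≤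
  -- 0`.
  obtain ⟨t, ht, hm⟩ := exists_lineMap_mem_of_mem_intrinsicInterior hp hc
  have h1 := hm.1 y
  simp only [AffineMap.lineMap_apply_module, PiLp.add_apply, PiLp.smul_apply,
    PiLp.single_apply, if_true, smul_eq_mul] at h1
  by_contra hle
  have : t * p y ≤ 0 := mul_nonpos_of_nonneg_of_nonpos (by linarith) (not_lt.1 hle)
  linarith

end Simplex

/-! ### Subgradients sum to one; coercivity and existence of minimizers. -/

section Range

variable {𝒴 Ω : Type*} [Fintype 𝒴] [Nonempty 𝒴] [MeasurableSpace Ω]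
  {γ : 𝒴 → Ω → ℝ} {P : Measure Ω}

theorem expectedPerturbedMax_add_const [IsProbabilityMeasure P]
    (hint : ∀ θ : EuclideanSpace ℝ 𝒴, Integrable (perturbedMax γ θ) P)
    (θ : EuclideanSpace ℝ 𝒴) (c : ℝ) :
    expectedPerturbedMax γ P (θ + WithLp.toLp 2 (fun _ => c)) =
      expectedPerturbedMax γ P θ + c := by
  have h : ∀ a, perturbedMax γ (θ + WithLp.toLp 2 (fun _ => c)) a = perturbedMax γ θ a + c := by
    intro a
    obtain ⟨y, hy⟩ := exists_perturbedMax_eq γ θ a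
    rw [perturbedMax_eq_of_forall_le (y := y), hy]
    · simp only [PiLp.add_apply]; ring
    · intro z
      have := hy ▸ le_perturbedMax (γ := γ) θ a z
      simp only [PiLp.add_apply]
      linarith
  simp only [expectedPerturbedMax, h]
  rw [integral_add (hint θ) (integrable_const c)]
  simp

theorem sum_eq_one_of_mem_subdifferential [IsProbabilityMeasure P]
    (hint : ∀ θ : EuclideanSpace ℝ 𝒴, Integrable (perturbedMax γ θ) P)
    {θ v : EuclideanSpace ℝ 𝒴} (hv : v ∈ subdifferential (expectedPerturbedMax γ P) θ) :
    ∑ y, v y = 1 := by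
  have key : ∀ c : ℝ, c * ∑ y, v y ≤ c := fun c => by
    have := hv (θ + WithLp.toLp 2 (fun _ => c))
    rw [expectedPerturbedMax_add_const hint, add_sub_cancel_left] at this
    simp only [PiLp.inner_apply, RCLike.inner_apply, conj_trivial, ← Finset.mul_sum] at this
    linarith
  -- Opposite shifts give the two inequalities.
  linarith [key 1, key (-1)]

theorem exists_measureReal_compl_lt [IsFiniteMeasure P] (hγ : ∀ y, AEMeasurable (γ y) P)
    {ε : ℝ} (hε : 0 < ε) :
    ∃ M : ℝ, NullMeasurableSet {a | ∀ y, -M ≤ γ y a} P ∧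
      P.real {a | ∀ y, -M ≤ γ y a}ᶜ < ε := by
  have hmeas : ∀ M : ℝ, NullMeasurableSet {a | ∀ y, -M ≤ γ y a} P := fun M => by
    rw [ofPred_forall]
    exact NullMeasurableSet.iInter fun y => nullMeasurableSet_le aemeasurable_const (hγ y)
  have hlim : Tendsto (fun n : ℕ => P.real {a | ∀ y, -(n : ℝ) ≤ γ y a}ᶜ) atTop (𝓝 0) := by
    have h0 : ⋂ n : ℕ, {a | ∀ y, -(n : ℝ) ≤ γ y a}ᶜ = ∅ := by
      refine eq_empty_of_forall_notMem fun a ha => ?_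
      obtain ⟨n, hn⟩ := exists_nat_ge (Finset.univ.sup' Finset.univ_nonempty (fun y => -γ y a))
      refine mem_iInter.1 ha n fun y => ?_
      have := Finset.le_sup' (fun y => -γ y a) (Finset.mem_univ y)
      linarith
    have := tendsto_measure_iInter_atTop (μ := P)
      (s := fun n : ℕ => {a | ∀ y, -(n : ℝ) ≤ γ y a}ᶜ) (fun n => (hmeas n).compl)
      (fun m n hmn a ha h => ha fun y => by
        have h1 : (m : ℝ) ≤ n := by exact_mod_cast hmn
        linarith [h y]) ⟨0, measure_ne_top _ _⟩
    rw [h0, measure_empty] at this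
    exact (ENNReal.tendsto_toReal ENNReal.zero_ne_top).comp this
  obtain ⟨n, hn⟩ := (hlim.eventually_lt_const hε).exists
  exact ⟨n, hmeas n, hn⟩

/-- For nonnegative `θ` vanishing somewhere, `f(θ) - ⟨p, θ⟩` grows linearly in `max θ` when all
coordinates of `p` are positive. -/
theorem exists_coercive_bound [IsProbabilityMeasure P] (hγ : ∀ y, AEMeasurable (γ y) P)
    (hint : ∀ θ : EuclideanSpace ℝ 𝒴, Integrable (perturbedMax γ θ) P)
    {p : EuclideanSpace ℝ 𝒴} (hpos : ∀ y, 0 < p y) (hsum : ∑ y, p y = 1) :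
    ∃ δ > 0, ∃ C : ℝ, ∀ θ : EuclideanSpace ℝ 𝒴, (∀ y, 0 ≤ θ y) → (∃ y, θ y = 0) →
      ∀ y, δ * θ y - C ≤ expectedPerturbedMax γ P θ - inner ℝ p θ := by
  classical
  obtain ⟨y₀, -, hy₀⟩ := Finset.exists_min_image Finset.univ (fun y => p y) Finset.univ_nonempty
  set ε := p y₀ with hεdef
  have hε : 0 < ε := hpos y₀
  -- The linear term costs at most `(1 - ε) * max θ`, and the expectation gains at least `(1 - ε /
  -- 2) * max θ` up to a constant, which leaves slope `ε / 2`.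
  obtain ⟨M, hA, hM⟩ := exists_measureReal_compl_lt hγ (half_pos hε)
  set A : Set Ω := {a | ∀ y, -M ≤ γ y a} with hAdef
  have hAc : P.real Aᶜ = 1 - P.real A := by
    have := measureReal_add_measureReal_compl₀ (μ := P) hA
    simp at this
    linarith
  refine ⟨ε / 2, half_pos hε, |M| + ∫ a, |perturbedMax γ 0 a| ∂P, fun θ hθ ⟨z, hz⟩ y => ?_⟩
  obtain ⟨m, -, hm⟩ := Finset.exists_max_image Finset.univ (fun y => θ y) Finset.univ_nonempty
  have hinner : inner ℝ p θ ≤ (1 - ε) * θ m := by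
    have h1 : inner ℝ p θ = ∑ y, p y * θ y := by
      simp [PiLp.inner_apply, mul_comm]
    have h2 : ∑ y, p y * (θ m - θ y) ≥ p z * (θ m - θ z) :=
      Finset.single_le_sum (f := fun y => p y * (θ m - θ y))
        (fun y _ => mul_nonneg (hpos y).le (sub_nonneg.2 (hm y (Finset.mem_univ y))))
        (Finset.mem_univ z)
    simp only [mul_sub, Finset.sum_sub_distrib, ← Finset.sum_mul, hsum, hz] at h2
    have h3 : ε * θ m ≤ p z * θ m :=
      mul_le_mul_of_nonneg_right (hy₀ z (Finset.mem_univ z)) (hθ m)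
    linarith
  have hlow : θ m * P.real A - |M| - ∫ a, |perturbedMax γ 0 a| ∂P ≤
      expectedPerturbedMax γ P θ := by
    have hi1 : Integrable (A.indicator fun _ => θ m) P := (integrable_const _).indicator₀ hA
    have hi2 : Integrable (fun a => |perturbedMax γ 0 a|) P := (hint 0).abs
    have hi3 : Integrable (fun _ : Ω => |M|) P := integrable_const _
    have : ∫ a, (A.indicator (fun _ => θ m) a - |M| - |perturbedMax γ 0 a|) ∂P ≤
        expectedPerturbedMax γ P θ := by
      refine integral_mono ((hi1.sub hi3).sub hi2) (hint θ) fun a => ?_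
      -- On `A` the bound comes from the largest coordinate `m` of `θ`; off `A`, from the maximizer
      -- `w` of the noise alone, as `θ w ≥ 0`.
      by_cases ha : a ∈ A
      · have h1 := le_perturbedMax (γ := γ) θ a m
        have h2 : -M ≤ γ m a := ha m
        simp only [indicator_of_mem ha]
        linarith [le_abs_self M, abs_nonneg (perturbedMax γ 0 a)]
      · obtain ⟨w, hw⟩ := exists_perturbedMax_eq γ 0 a
        have h1 := le_perturbedMax (γ := γ) θ a w
        simp only [indicator_of_notMem ha]
        simp only [PiLp.zero_apply, zero_add] at hw
        have h2 := neg_abs_le (perturbedMax γ 0 a)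
        linarith [hθ w, abs_nonneg M]
    have h1 := integral_sub (hi1.sub hi3) hi2
    simp only [Pi.sub_apply] at h1
    rw [h1, integral_sub hi1 hi3, integral_indicator₀ hA, setIntegral_const] at this
    simp only [integral_const, probReal_univ, smul_eq_mul] at this
    linarith
  have h4 : θ m * (1 - ε / 2) ≤ θ m * P.real A :=
    mul_le_mul_of_nonneg_left (by linarith) (hθ m)
  have h5 : ε / 2 * θ y ≤ ε / 2 * θ m :=
    mul_le_mul_of_nonneg_left (hm y (Finset.mem_univ y)) (half_pos hε).le
  linarith

theorem mem_rangeSubdifferential_of_pos [IsProbabilityMeasure P]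
    (hγ : ∀ y, AEMeasurable (γ y) P)
    (hint : ∀ θ : EuclideanSpace ℝ 𝒴, Integrable (perturbedMax γ θ) P)
    (hcont : Continuous (expectedPerturbedMax γ P))
    {p : EuclideanSpace ℝ 𝒴} (hpos : ∀ y, 0 < p y) (hsum : ∑ y, p y = 1) :
    p ∈ rangeSubdifferential (expectedPerturbedMax γ P) := by
  obtain ⟨δ, hδ, C, hC⟩ := exists_coercive_bound hγ hint hpos hsum
  set g : EuclideanSpace ℝ 𝒴 → ℝ := fun θ => expectedPerturbedMax γ P θ - inner ℝ p θ with hg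
  have hgc : Continuous g := by fun_prop
  -- Beyond `R` in some coordinate, the coercive bound exceeds `g 0`.
  set R := max 0 ((C + g 0) / δ) with hR
  let K : Set (EuclideanSpace ℝ 𝒴) := WithLp.toLp 2 '' (univ.pi fun _ : 𝒴 => Icc (0 : ℝ) R)
  have hK : IsCompact K :=
    (isCompact_univ_pi fun _ => isCompact_Icc).image (PiLp.continuous_toLp 2 _)
  have memK : ∀ θ : EuclideanSpace ℝ 𝒴, (∀ y, θ y ∈ Icc 0 R) → θ ∈ K := fun θ h =>
    ⟨WithLp.ofLp θ, fun y _ => h y, rfl⟩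
  have h0 : (0 : EuclideanSpace ℝ 𝒴) ∈ K := memK 0 fun y => ⟨le_rfl, le_max_left _ _⟩
  obtain ⟨θ, -, hmin⟩ := hK.exists_isMinOn ⟨0, h0⟩ hgc.continuousOn
  have hmin' : ∀ η, g θ ≤ g η := by
    intro η
    obtain ⟨w, -, hw⟩ := Finset.exists_min_image Finset.univ (fun y => η y) Finset.univ_nonempty
    -- The shift makes the smallest coordinate zero without changing `g`.
    set ζ : EuclideanSpace ℝ 𝒴 := η + WithLp.toLp 2 (fun _ => -η w) with hζ
    have hζy : ∀ y, ζ y = η y - η w := fun y => by simp [hζ, sub_eq_add_neg]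
    have hζg : g ζ = g η := by
      have h1 : inner ℝ p ζ = inner ℝ p η - η w := by
        simp [hζ, inner_add_right, PiLp.inner_apply, ← Finset.mul_sum, hsum, sub_eq_add_neg]
      simp only [hg, h1]
      rw [hζ, expectedPerturbedMax_add_const hint]
      ring
    have hζ0 : ∀ y, 0 ≤ ζ y := fun y => by
      rw [hζy]; exact sub_nonneg.2 (hw y (Finset.mem_univ y))
    rw [← hζg]
    by_cases hb : ∀ y, ζ y ≤ R
    · exact hmin (memK ζ fun y => ⟨hζ0 y, hb y⟩)
    · push Not at hb
      obtain ⟨y, hy⟩ := hb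
      have h1 := hC ζ hζ0 ⟨w, by rw [hζy, sub_self]⟩ y
      have h2 : (C + g 0) / δ < ζ y := (le_max_right _ _).trans_lt hy
      rw [div_lt_iff₀ hδ] at h2
      have h3 : g θ ≤ g 0 := hmin h0
      change _ ≤ g ζ at h1
      linarith
  refine mem_iUnion.2 ⟨θ, fun η => ?_⟩
  have := hmin' η
  simp only [hg] at this
  rw [inner_sub_right]
  linarith

end Range

/-! ### Ties are null. -/

section Ties

/-- By Fubini: with `X` frozen, a tie forces `Y` to hit one point, which is null. -/
theorem ae_ne_of_indepFun {Ω : Type*} [MeasurableSpace Ω] {P : Measure Ω}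
    [IsFiniteMeasure P] {X Y : Ω → ℝ} (hX : AEMeasurable X P) (hY : AEMeasurable Y P)
    (hXY : IndepFun X Y P) [NullSingletonClass (P.map Y)] (s t : ℝ) :
    ∀ᵐ a ∂P, s + X a ≠ t + Y a := by
  have h1 := (indepFun_iff_map_prod_eq_prod_map_map hX hY).1 hXY
  have hm : MeasurableSet {x : ℝ × ℝ | s + x.1 ≠ t + x.2} :=
    (measurableSet_eq_fun (by fun_prop) (by fun_prop)).compl
  have h2 : ∀ᵐ x ∂(P.map fun a => (X a, Y a)), s + x.1 ≠ t + x.2 := by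
    rw [h1, Measure.ae_prod_iff_ae_ae hm]
    refine ae_of_all _ fun x => ?_
    have : ∀ᵐ y ∂(P.map Y), y ≠ s + x - t := by
      simp [ae_iff]
    filter_upwards [this] with y hy h
    exact hy (by linarith)
  exact ae_of_ae_map (hX.prodMk hY) h2

end Ties

theorem mainTheorem2 {𝒴 Ω : Type*} [Fintype 𝒴] [Nonempty 𝒴] [MeasurableSpace Ω]
    (P : Measure Ω) [IsProbabilityMeasure P]
    (q : ℝ → ℝ) (hq_smooth : ContDiff ℝ ((⊤ : ℕ∞) : WithTop ℕ∞) q) (hq_nonneg : ∀ x, 0 ≤ q x)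
    (γ : 𝒴 → Ω → ℝ) (hγ_indep : iIndepFun γ P)
    (hγ_law : ∀ y, HasLaw (γ y) (volume.withDensity (fun x => ENNReal.ofReal (q x))) P)
    (hf_finite : ∀ θ : EuclideanSpace ℝ 𝒴, Integrable (perturbedMax γ θ) P) :
    (∀ θ : EuclideanSpace ℝ 𝒴,
      HasGradientAt (expectedPerturbedMax γ P) (argmaxProb γ P θ) θ ∧
      subdifferential (expectedPerturbedMax γ P) θ = {argmaxProb γ P θ}) ∧
    intrinsicInterior ℝ (probSimplex 𝒴) ⊆ rangeSubdifferential (expectedPerturbedMax γ P) ∧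
    rangeSubdifferential (expectedPerturbedMax γ P) ⊆ probSimplex 𝒴 := by

  have hm : ∀ y, AEMeasurable (γ y) P := fun y => (hγ_law y).aemeasurable
  have hties : ∀ θ : EuclideanSpace ℝ 𝒴,
      ∀ᵐ a ∂P, ∀ y z, y ≠ z → θ y + γ y a ≠ θ z + γ z a := fun θ => by
    refine ae_all_iff.2 fun y => ae_all_iff.2 fun z => ?_
    by_cases hyz : y = z
    · exact ae_of_all _ fun a h => absurd hyz h
    · have : NullSingletonClass (P.map (γ z)) := by
        rw [(hγ_law z).map_eq]; infer_instance
      filter_upwards [ae_ne_of_indepFun (hm y) (hm z) (hγ_indep.indepFun hyz) (θ y) (θ z)]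
        with a ha _ using ha
  have hgrad : ∀ θ, HasGradientAt (expectedPerturbedMax γ P) (argmaxProb γ P θ) θ := fun θ =>
    hasGradientAt_expectedPerturbedMax hm hf_finite (hties θ)
  have hsub : ∀ θ, subdifferential (expectedPerturbedMax γ P) θ = {argmaxProb γ P θ} :=
    fun θ => Subset.antisymm
      (fun v hv => eq_of_mem_subdifferential_of_hasGradientAt hv (hgrad θ))
      (singleton_subset_iff.2 (argmaxProb_mem_subdifferential hm hf_finite (hties θ)))
  refine ⟨fun θ => ⟨hgrad θ, hsub θ⟩, fun p hp => ?_, fun p hp => ?_⟩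
  · exact mem_rangeSubdifferential_of_pos hm hf_finite
      (continuous_iff_continuousAt.2 fun θ => (hgrad θ).continuousAt)
      (pos_of_mem_intrinsicInterior_probSimplex hp) (intrinsicInterior_subset hp).2
  · obtain ⟨θ, hθ⟩ := mem_iUnion.1 hp
    refine ⟨fun y => ?_, sum_eq_one_of_mem_subdifferential hf_finite hθ⟩
    rw [hsub θ, mem_singleton_iff] at hθ
    rw [hθ]
    exact measureReal_nonneg
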